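/- Let $\tau\in\mathbb C$ with $\operatorname{Im}\tau>0$, put $q=e^{2\pi i\tau}$ (so $0<|q|<1$), and write $q^{r}=e^{2\pi i r\tau}$ for $r\in\mathbb Q$. Let $(x;q)_n=\prod_{i=0}^{n-1}(1-q^{i}x)$ and, for $0\le k\le n$, $\binom{n}{k}_q=\frac{(q;q)_n}{(q;q)_k(q;q)_{n-k}}$. For $k,\ell\in\mathbb Z$ define $$\beta_{k,\ell}(q)=\begin{cases}\dfrac{(-1)^{k+\ell}q^{\frac32k(k+1)+\frac12\ell(\ell+1)+k+1}(q;q)_{-\ell-1}}{(q;q)_{-2k-2}\,(q;q)_{k-\ell}}&\text{if }\ell\le k\le-1,\\[2mm]0&\text{otherwise,}\end{cases}$$ and, for $m,n\in\mathbb Z$, $$Z_{m,n}(q)=\sum_{k,\ell\in\mathbb Z}\beta_{k,\ell}(q)\,q^{mk+n\ell}=\sum_{0\le k\le\ell}(-1)^{k+\ell}q^{\frac32k(k+1)+\frac12\ell(\ell+1)-(m+1)k-m-n\ell-n}\frac{(q;q)_\ell}{(q;q)_{2k}(q;q)_{\ell-k}}.$$ For $N\in\mathbb Z_{\ge0}$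 let $\theta_N(q)=q^{2(N+3/4)^2}-q^{2(N+7/4)^2}-q^{2(N+1/4)^2}+q^{2(N+5/4)^2}$, let $$\widehat Z(q)=q^{3/8}\sum_{k,j,\ell=0}^{\infty}\theta_{k+j+\ell}(q)\binom{k+j}{j}_q\binom{k+\ell}{\ell}_{q^{-1}}$$ be the series given by the Gukov--Manolescu surgery formula for $-1/2$ surgery on the figure-eight knot, and for $m\in\mathbb Z$ let $$\widehat Z_m(q)=q^{3/8}\sum_{k,j,\ell=0}^{\infty}\theta_{k+j+\ell}(q)\binom{k+j}{j}_q\binom{k+\ell}{\ell}_{q^{-1}}\,q^{-mk-m}.$$ Then for every $m\in\mathbb Z$ the series defining $\widehat Z_m(q)$ and $Z_{m,0}(q)$ converge absolutely, and $$\widehat Z_m(q)=-q^{1/2}Z_{m,0}(q).$$ In particular, the series defining $\widehat Z(q)$ converges absolutely and $\widehat Z(q)=-q^{1/2}Z_{0,0}(q)$. -/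

import Mathlib

noncomputable section

namespace FigEightSurgery

/-- The power `q ^ r` for a rational exponent `r`, where `q = exp (2 π i τ)`:
`q ^ r = exp (2 π i r τ)`. -/
def qpow (τ : ℂ) (r : ℚ) : ℂ :=
  Complex.exp (2 * Real.pi * Complex.I * (r : ℂ) * τ)

/-- The `q`-Pochhammer symbol `(x; q)_n = (1 - x) (1 - q x) ⋯ (1 - q ^ (n - 1) x)`. -/
def qPoch (x q : ℂ) (n : ℕ) : ℂ :=
  ∏ i ∈ Finset.range n, (1 - q ^ i * x)

/-- The `q`-binomial coefficient `(q; q)_n / ((q; q)_k (q; q)_{n - k})`, for `k ≤ n` (and `0`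
for `n < k`). It is used only at `q` which are neither zero nor roots of unity, where no
denominator vanishes. -/
def qBinom (q : ℂ) (n k : ℕ) : ℂ :=
  if k ≤ n then qPoch q q n / (qPoch q q k * qPoch q q (n - k)) else 0

/-- The second solution `β : ℤ² → ℚ(q)` of the recursions satisfied by the summand of the WRT
invariant, evaluated at a complex number `q`. The integer divisions by two are exact, and the
arguments of `Int.toNat` are nonnegative in the branch where they are used. -/
def beta (q : ℂ) (k l : ℤ) : ℂ :=
  if l ≤ k ∧ k ≤ -1 then
    (-1) ^ (k + l) * q ^ (3 * k * (k + 1) / 2 + l * (l + 1) / 2 + k + 1) *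
      qPoch q q (-l - 1).toNat / (qPoch q q (-2 * k - 2).toNat * qPoch q q (k - l).toNat)
  else 0

/-- The summand of `Z_{m,n}(q)`. -/
def ZTerm (m n : ℤ) (q : ℂ) (p : ℤ × ℤ) : ℂ :=
  beta q p.1 p.2 * q ^ (m * p.1 + n * p.2)

/-- `Z_{m,n}(q) = ∑_{k,l ∈ ℤ} β_{k,l}(q) q ^ (m k + n l)`. -/
def Z (m n : ℤ) (q : ℂ) : ℂ :=
  ∑' p : ℤ × ℤ, ZTerm m n q p

/-- The theta-like factor
`q^{2(N+3/4)²} - q^{2(N+7/4)²} - q^{2(N+1/4)²} + q^{2(N+5/4)²}`. -/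
def thetaTerm (τ : ℂ) (N : ℕ) : ℂ :=
  qpow τ (2 * ((N : ℚ) + 3 / 4) ^ 2) - qpow τ (2 * ((N : ℚ) + 7 / 4) ^ 2)
    - qpow τ (2 * ((N : ℚ) + 1 / 4) ^ 2) + qpow τ (2 * ((N : ℚ) + 5 / 4) ^ 2)

/-- The summand, indexed by `(k, j, l)`, of the surgery formula series `Ẑ(q)`. -/
def ZhatTerm (τ : ℂ) (p : ℕ × ℕ × ℕ) : ℂ :=
  thetaTerm τ (p.1 + p.2.1 + p.2.2) *
    qBinom (qpow τ 1) (p.1 + p.2.1) p.2.1 * qBinom (qpow τ 1)⁻¹ (p.1 + p.2.2) p.2.2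

/-- The surgery formula series `Ẑ(q)`, with `q = exp (2 π i τ)`. -/
def Zhat (τ : ℂ) : ℂ :=
  qpow τ (3 / 8) * ∑' p : ℕ × ℕ × ℕ, ZhatTerm τ p

/-- The summand, indexed by `(k, j, l)`, of `Ẑ_m(q)`. -/
def ZhatTermM (m : ℤ) (τ : ℂ) (p : ℕ × ℕ × ℕ) : ℂ :=
  ZhatTerm τ p * (qpow τ 1) ^ (-m * (p.1 : ℤ) - m)

/-- The series `Ẑ_m(q)`, with `q = exp (2 π i τ)`. -/
def ZhatM (m : ℤ) (τ : ℂ) : ℂ :=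
  qpow τ (3 / 8) * ∑' p : ℕ × ℕ × ℕ, ZhatTermM m τ p

end FigEightSurgery

end

/-!
The theta factor `θ_N` is, up to a power of `q`, a difference `w N - w (N + 1)`. For fixed `k`, sum
the surgery series over `j + l = s` first: the weight then multiplies the coefficient of `X ^ s` in
`1 / ((X; q)_{k+1} (q ^ (-k) X; q)_{k+1})`, and summation by parts in `s` multiplies this generating
function by `1 - X`. The two products then merge into `1 / (q ^ (-k) X; q)_{2k+1}`, whose
coefficients are single `q`-binomial coefficients, so the triple sum becomes a double sum over `k`
and `s`.

For each `k` the sum over `s` is the very-well-poised side of a limiting case of Watson's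
transformation, which follows from Bailey's lemma for the Bailey pair with `β_n = 1 / (q; q)_n` and
a conjugate Bailey pair coming from a `₁φ₁` summation. The other side of the transformation is the
part of `Z_{m,0}` supported on the line of points `(-k - 1, -k - r - 1)` with `r ≥ 0`. The extra
factor `q ^ (-m k - m)` depends on `k` alone, so the same computation serves every `m`.
-/

namespace FigEightSurgery

open Filter Finset Topology

/-! ### Binomial coefficients `n.choose 2` -/

lemma choose_two_succ (n : ℕ) : (n + 1).choose 2 = n + n.choose 2 := by
  rw [Nat.choose_succ_succ', Nat.choose_one_right]

lemma two_mul_choose_two_succ (n : ℕ) : 2 * (n + 1).choose 2 = (n + 1) * n := by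
  simpa [mul_comm] using (Nat.add_one_mul_choose_eq n 1).symm

lemma mul_two_mul_add_one (n : ℕ) : n * (2 * n + 1) = 4 * n.choose 2 + 3 * n := by
  have := two_mul_choose_two_succ n
  have := choose_two_succ n
  linarith

lemma add_choose_two (m n : ℕ) : (m + n).choose 2 = m.choose 2 + n.choose 2 + m * n := by
  induction n with
  | zero => simp
  | succ n ih => rw [← add_assoc, choose_two_succ, choose_two_succ, ih]; ring

/-! ### The `q`-Pochhammer symbol -/

section qPoch

variable {x q : ℂ}

lemma qPoch_zero (x q : ℂ) : qPoch x q 0 = 1 := prod_range_zero _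

lemma qPoch_succ (x q : ℂ) (n : ℕ) : qPoch x q (n + 1) = qPoch x q n * (1 - q ^ n * x) :=
  prod_range_succ _ n

lemma qPoch_add (x q : ℂ) (m n : ℕ) :
    qPoch x q (m + n) = qPoch x q m * qPoch (q ^ m * x) q n := by
  rw [qPoch, qPoch, qPoch, prod_range_add]
  congr! 3
  ring

lemma inv_qPoch (hx : ∀ n, q ^ n * x ≠ 1) (n : ℕ) :
    (qPoch x q n)⁻¹ = (1 - q ^ n * x) * (qPoch x q (n + 1))⁻¹ := by
  have := sub_ne_zero.mpr (hx n).symm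
  rw [qPoch_succ, mul_inv, mul_left_comm, mul_inv_cancel₀ this, mul_one]

lemma qPoch_ne_zero (hx : ∀ n, q ^ n * x ≠ 1) (n : ℕ) : qPoch x q n ≠ 0 :=
  prod_ne_zero_iff.mpr fun i _ => sub_ne_zero.mpr (hx i).symm

lemma inv_qPoch_pow_mul (hx : ∀ n, q ^ n * x ≠ 1) {k m s n : ℕ} (h : k + m = s + n) :
    (qPoch (q ^ k * x) q m)⁻¹ =
      qPoch x q k * (qPoch x q s)⁻¹ * (qPoch (q ^ s * x) q n)⁻¹ := by
  rw [mul_assoc, ← mul_inv, ← qPoch_add, ← h, qPoch_add, mul_inv,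
    mul_inv_cancel_left₀ (qPoch_ne_zero hx k)]

lemma qPoch_inv (hq : q ≠ 0) (n : ℕ) :
    qPoch q⁻¹ q⁻¹ n = (-1) ^ n * (q ^ (n + 1).choose 2)⁻¹ * qPoch q q n := by
  induction n with
  | zero => simp [qPoch_zero]
  | succ n ih =>
    rw [qPoch_succ, qPoch_succ, ih, choose_two_succ (n + 1), inv_pow]
    field_simp
    ring

lemma pow_mul_ne_one (hq : ‖q‖ ≤ 1) (hx : ‖x‖ < 1) (n : ℕ) : q ^ n * x ≠ 1 := by
  refine ne_of_apply_ne norm (ne_of_lt ?_)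
  rw [norm_mul, norm_pow, norm_one]
  exact mul_lt_one_of_nonneg_of_lt_one_right (pow_le_one₀ (norm_nonneg q) hq) (norm_nonneg x) hx

lemma pow_mul_pow_mul_ne_one (hx : ∀ n, q ^ n * x ≠ 1) (k n : ℕ) :
    q ^ n * (q ^ k * x) ≠ 1 := by
  rw [← mul_assoc, ← pow_add]
  exact hx (n + k)

lemma norm_one_sub_pow_mul_le (hq : ‖q‖ ≤ 1) (x : ℂ) (n : ℕ) : ‖1 - q ^ n * x‖ ≤ 1 + ‖x‖ := by
  refine norm_sub_le_of_le norm_one.le ?_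
  rw [norm_mul, norm_pow]
  exact mul_le_of_le_one_left (norm_nonneg x) (pow_le_one₀ (norm_nonneg q) hq)

lemma summable_norm_neg_pow_mul (hq : ‖q‖ < 1) (x : ℂ) : Summable fun n : ℕ => ‖-(q ^ n * x)‖ := by
  simpa only [norm_neg, norm_mul, norm_pow] using
    (summable_geometric_of_lt_one (norm_nonneg q) hq).mul_right ‖x‖

lemma tendsto_qPoch (hq : ‖q‖ < 1) (x : ℂ) :
    Tendsto (qPoch x q) atTop (𝓝 (∏' n : ℕ, (1 + -(q ^ n * x)))) :=
  (multipliable_one_add_of_summable (summable_norm_neg_pow_mul hq x)).hasProd.tendsto_prod_nat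

lemma exists_norm_qPoch_le (hq : ‖q‖ < 1) (x : ℂ) : ∃ C, ∀ n, ‖qPoch x q n‖ ≤ C := by
  simpa using (Metric.isBounded_range_of_tendsto _ (tendsto_qPoch hq x)).exists_norm_le

lemma exists_norm_inv_qPoch_le (hq : ‖q‖ < 1) (hx : ∀ n, q ^ n * x ≠ 1) :
    ∃ C, ∀ n, ‖(qPoch x q n)⁻¹‖ ≤ C := by
  have hlim : ∏' n : ℕ, (1 + -(q ^ n * x)) ≠ 0 :=
    tprod_one_add_ne_zero_of_summable
      (fun n => by simpa only [← sub_eq_add_neg] using sub_ne_zero.mpr (hx n).symm)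
      (summable_norm_neg_pow_mul hq x)
  simpa using (Metric.isBounded_range_of_tendsto _ ((tendsto_qPoch hq x).inv₀ hlim)).exists_norm_le

end qPoch

/-! ### Summation -/

lemma summable_mul_of_norm_le {ι R : Type*} [NormedRing R] [CompleteSpace R] {f g : ι → R} {C : ℝ}
    (hf : Summable fun i => ‖f i‖) (hg : ∀ i, ‖g i‖ ≤ C) : Summable fun i => f i * g i :=
  .of_norm_bounded (hf.mul_right C) fun i => norm_mul_le_of_le le_rfl (hg i)

lemma summable_pow_choose_two_mul_pow {𝕜 : Type*} [NormedField 𝕜] [CompleteSpace 𝕜] {q : 𝕜}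
    (hq : ‖q‖ < 1) (y : 𝕜) : Summable fun n : ℕ => q ^ n.choose 2 * y ^ n := by
  refine summable_of_ratio_norm_eventually_le one_half_lt_one ?_
  have hratio : Tendsto (fun n => ‖q ^ n * y‖) atTop (𝓝 0) := by
    simpa using ((tendsto_pow_atTop_nhds_zero_of_norm_lt_one hq).mul_const y).norm
  filter_upwards [hratio.eventually_le_const one_half_pos] with n hn
  calc ‖q ^ (n + 1).choose 2 * y ^ (n + 1)‖ = ‖q ^ n * y‖ * ‖q ^ n.choose 2 * y ^ n‖ := by
        rw [choose_two_succ, ← norm_mul]; ring_nf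
    _ ≤ 1 / 2 * ‖q ^ n.choose 2 * y ^ n‖ := by gcongr

lemma hasSum_sub_succ {G : Type*} [AddCommGroup G] [TopologicalSpace G] [IsTopologicalAddGroup G]
    {f : ℕ → G} (hf : Summable f) : HasSum (fun n => f n - f (n + 1)) (f 0) := by
  simpa using hf.hasSum.sub ((hasSum_nat_add_iff' 1).mpr hf.hasSum)

lemma hasSum_mul_of_hasSum_sub_succ {R : Type*} [Ring R] [TopologicalSpace R]
    [IsTopologicalAddGroup R] {w c d : ℕ → R} {a b : R} (hd0 : d 0 = c 0)
    (hd : ∀ n, d (n + 1) = c (n + 1) - c n) (ha : HasSum (fun n => w n * c n) a)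
    (hb : HasSum (fun n => w (n + 1) * c n) b) : HasSum (fun n => w n * d n) (a - b) := by
  rw [← hasSum_nat_add_iff' 1, sum_range_one, sub_right_comm, hd0]
  simpa only [hd, mul_sub, sum_range_one] using ((hasSum_nat_add_iff' 1).mpr ha).sub hb

lemma hasSum_sum_antidiagonal {M : Type*} [AddCommMonoid M] [TopologicalSpace M] [ContinuousAdd M]
    [RegularSpace M] {f : ℕ × ℕ → M} {a : M} (hf : HasSum f a) :
    HasSum (fun n => ∑ p ∈ antidiagonal n, f p) a := by
  refine ((HasAntidiagonal.sigmaAntidiagonalEquivProd (A := ℕ)).hasSum_iff.mpr hf).sigma fun n => ?_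
  rw [← sum_coe_sort]
  exact hasSum_fintype fun p : antidiagonal n => f p

lemma hasSum_bailey_transform {R : Type*} [CommSemiring R] [TopologicalSpace R]
    [IsTopologicalSemiring R] [T3Space R] {α β γ δ u v : ℕ → R}
    (hβ : ∀ r, ∑ s ∈ range (r + 1), α s * u (r - s) * v (r + s) = β r)
    (hγ : ∀ s, HasSum (fun t => δ (s + t) * u t * v (2 * s + t)) (γ s))
    (h : Summable fun p : ℕ × ℕ => α p.1 * (δ (p.1 + p.2) * u p.2 * v (2 * p.1 + p.2))) :
    HasSum (fun s => α s * γ s) (∑' r, δ r * β r) := by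
  have hαγ := h.hasSum.prod_fiberwise fun s => (hγ s).mul_left (α s)
  have hβδ := hasSum_sum_antidiagonal h.hasSum
  convert hαγ
  rw [← hβδ.tsum_eq]
  refine tsum_congr fun r => ?_
  rw [← hβ, mul_sum, Nat.sum_antidiagonal_eq_sum_range_succ_mk]
  refine sum_congr rfl fun s hs => ?_
  have hsr : s ≤ r := Nat.lt_succ_iff.mp (mem_range.mp hs)
  rw [Nat.add_sub_cancel' hsr, show 2 * s + (r - s) = r + s by omega]
  ring

/-! ### A limiting case of Watson's transformation -/

section Watson

variable {q : ℂ}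

/-- The sequence `α` of the Bailey pair relative to `a` whose `β` is `1 / (q; q)_n`, without its
usual denominator `1 - a`: accordingly `(a; q)_{r + s + 1}` replaces `(a q; q)_{r + s}` in the
relation between `α` and `β`. The power of `q` is the pentagonal number `n (3 n - 1) / 2`. -/
noncomputable def baileyAlpha (a q : ℂ) (n : ℕ) : ℂ :=
  (-1) ^ n * q ^ (n + 3 * n.choose 2) * a ^ n * (1 - q ^ (2 * n) * a) * qPoch a q n / qPoch q q n

/-- The `s`-th summand of `β_r` for the Bailey pair with `α = baileyAlpha a q`. -/
noncomputable def baileyTerm (a q : ℂ) (r s : ℕ) : ℂ :=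
  baileyAlpha a q s * (qPoch q q (r - s))⁻¹ * (qPoch a q (r + s + 1))⁻¹

lemma sum_range_baileyTerm_sub (hq : ∀ n, q ^ n * q ≠ 1) {a : ℂ} (ha : ∀ n, q ^ n * a ≠ 1)
    {n r : ℕ} (hn : n ≤ r) :
    ∑ s ∈ range (n + 1), ((1 - q ^ (r + 1)) * baileyTerm a q (r + 1) s - baileyTerm a q r s) =
      (-1) ^ n * q ^ (r + 3 * (n + 1).choose 2 + 1) * a ^ (n + 1) * qPoch a q (n + 1) *
        (qPoch q q n)⁻¹ * (qPoch q q (r - n))⁻¹ * (qPoch a q (r + n + 2))⁻¹ := by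
  induction n with
  | zero =>
    simp only [baileyTerm, baileyAlpha, zero_add, range_one, sum_singleton, Nat.sub_zero, add_zero,
      Nat.choose_zero_succ, qPoch_succ a q 0, qPoch_zero, mul_zero, pow_zero,
      Nat.choose_succ_self, inv_qPoch hq r, inv_qPoch ha (r + 1)]
    ring
  | succ n ih =>
    obtain ⟨t, rfl⟩ := Nat.exists_eq_add_of_le hn
    rw [sum_range_succ, ih (by omega), baileyTerm, baileyTerm, baileyAlpha,
      show n + 1 + t + 1 - (n + 1) = t + 1 by omega, show n + 1 + t - (n + 1) = t by omega,
      show n + 1 + t - n = t + 1 by omega, choose_two_succ (n + 1),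
      show n + 1 + t + 1 + (n + 1) + 1 = 2 * n + t + 3 + 1 by ring,
      show n + 1 + t + (n + 1) + 1 = 2 * n + t + 3 by ring,
      show n + 1 + t + n + 2 = 2 * n + t + 3 by ring,
      show n + 1 + t + (n + 1) + 2 = 2 * n + t + 3 + 1 by ring,
      inv_qPoch ha (2 * n + t + 3), inv_qPoch hq n, inv_qPoch hq t, qPoch_succ a q (n + 1)]
    ring

lemma sum_range_baileyTerm (hq : ∀ n, q ^ n * q ≠ 1) {a : ℂ} (ha : ∀ n, q ^ n * a ≠ 1) (r : ℕ) :
    ∑ s ∈ range (r + 1), baileyTerm a q r s = (qPoch q q r)⁻¹ := by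
  induction r with
  | zero =>
    have ha₀ : 1 - a ≠ 0 := sub_ne_zero.mpr (by simpa using (ha 0).symm)
    simp [baileyTerm, baileyAlpha, qPoch_succ, qPoch_zero, mul_inv_cancel₀ ha₀]
  | succ r ih =>
    have hr : 1 - q ^ r * q ≠ 0 := sub_ne_zero.mpr (hq r).symm
    have hsub := sum_range_baileyTerm_sub hq ha (le_refl r)
    have hlast : (1 - q ^ (r + 1)) * baileyTerm a q (r + 1) (r + 1) =
        -((-1) ^ r * q ^ (r + 3 * (r + 1).choose 2 + 1) * a ^ (r + 1) * qPoch a q (r + 1) *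
        (qPoch q q r)⁻¹ * (qPoch q q (r - r))⁻¹ * (qPoch a q (r + r + 2))⁻¹) := by
      rw [baileyTerm, baileyAlpha, inv_qPoch hq r, show r + 1 + (r + 1) + 1 = r + r + 2 + 1 by ring,
        inv_qPoch ha (r + r + 2)]
      simp only [Nat.sub_self, qPoch_zero]
      ring
    rw [sum_sub_distrib, ← mul_sum, ih] at hsub
    apply mul_left_cancel₀ hr
    rw [sum_range_succ, ← inv_qPoch hq]
    linear_combination hsub + hlast

lemma hasSum_one_phi_one (hq : ‖q‖ < 1) {z : ℂ} (hz : ∀ n, q ^ n * z ≠ 1) (i : ℕ) :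
    HasSum (fun t => q ^ t.choose 2 * (-z) ^ t * qPoch q q (i + t) * (qPoch q q t)⁻¹ *
      (qPoch z q (i + 1 + t))⁻¹) (qPoch q q i) := by
  have hq' : ∀ n, q ^ n * q ≠ 1 := pow_mul_ne_one hq.le hq
  induction i with
  | zero =>
    obtain ⟨C, hC⟩ := exists_norm_inv_qPoch_le hq hz
    have hG : Summable fun t => q ^ t.choose 2 * (-z) ^ t * (qPoch z q t)⁻¹ :=
      summable_mul_of_norm_le (summable_pow_choose_two_mul_pow hq (-z)).norm hC
    have h := hasSum_sub_succ hG
    simp only [qPoch_zero, Nat.choose_zero_succ, pow_zero, inv_one, mul_one] at h ⊢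
    refine h.congr_fun fun t => ?_
    rw [zero_add, mul_assoc _ (qPoch q q t), mul_inv_cancel₀ (qPoch_ne_zero hq' t),
      choose_two_succ, inv_qPoch hz t, show 0 + 1 + t = t + 1 by ring]
    ring
  | succ i ih =>
    have hG : Summable fun t => q ^ (i + 1) * (q ^ t.choose 2 * (-z) ^ t * qPoch q q (i + t) *
        (qPoch q q t)⁻¹ * (qPoch z q (i + 1 + t))⁻¹) * (1 - q ^ t * 1) :=
      summable_mul_of_norm_le (ih.summable.mul_left (q ^ (i + 1))).norm
        (norm_one_sub_pow_mul_le hq.le 1)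
    have h := (ih.mul_left (1 - q ^ (i + 1))).add (hasSum_sub_succ hG)
    simp only [pow_zero, mul_one, sub_self, mul_zero, add_zero] at h
    rw [qPoch_succ, mul_comm, ← pow_succ]
    refine h.congr_fun fun t => ?_
    rw [show i + 1 + t = i + t + 1 by ring, show i + (t + 1) = i + t + 1 by ring,
      show i + 1 + (t + 1) = i + t + 1 + 1 by ring, show i + 1 + 1 + t = i + t + 1 + 1 by ring,
      choose_two_succ, qPoch_succ q q (i + t), inv_qPoch hz (i + t + 1), inv_qPoch hq' t]
    ring

lemma hasSum_conjugate_bailey (hq : ‖q‖ < 1) {b : ℂ} (hb : ∀ n, q ^ n * b ≠ 1) (k s : ℕ) :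
    HasSum (fun t => q ^ (s + t).choose 2 * (-b) ^ (s + t) * qPoch q q (k + (s + t)) *
        (qPoch q q t)⁻¹ * (qPoch (q ^ k * b) q (2 * s + t + 1))⁻¹)
      (q ^ s.choose 2 * (-b) ^ s * qPoch b q k * (qPoch b q s)⁻¹ * qPoch q q (k + s)) := by
  refine ((hasSum_one_phi_one hq (pow_mul_pow_mul_ne_one hb s) (k + s)).mul_left _).congr_fun
    fun t => ?_
  rw [inv_qPoch_pow_mul hb (s := s) (n := k + s + 1 + t) (by ring), add_choose_two,
    ← add_assoc k s t]
  ring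

lemma summable_watson (hq : ‖q‖ < 1) {b : ℂ} (hb : ∀ n, q ^ n * b ≠ 1) (k : ℕ) :
    Summable fun p : ℕ × ℕ => baileyAlpha (q ^ k * b) q p.1 *
      (q ^ (p.1 + p.2).choose 2 * (-b) ^ (p.1 + p.2) * qPoch q q (k + (p.1 + p.2)) *
        (qPoch q q p.2)⁻¹ * (qPoch (q ^ k * b) q (2 * p.1 + p.2 + 1))⁻¹) := by
  obtain ⟨A, hA⟩ := exists_norm_qPoch_le hq (q ^ k * b)
  obtain ⟨A', hA'⟩ := exists_norm_inv_qPoch_le hq (pow_mul_pow_mul_ne_one hb k)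
  obtain ⟨P, hP⟩ := exists_norm_qPoch_le hq q
  obtain ⟨P', hP'⟩ := exists_norm_inv_qPoch_le hq (pow_mul_ne_one hq.le hq)
  have hpow (n : ℕ) : ‖q ^ n‖ ≤ 1 := by
    rw [norm_pow]; exact pow_le_one₀ (norm_nonneg q) hq.le
  have hmain := summable_mul_of_summable_norm
    (summable_pow_choose_two_mul_pow hq (q ^ (k + 1) * b ^ 2)).norm
    (summable_pow_choose_two_mul_pow hq (-b)).norm
  refine (summable_mul_of_norm_le hmain.norm fun p : ℕ × ℕ =>
    norm_mul_le_of_le (norm_mul_le_of_le (norm_mul_le_of_le (hpow (3 * p.1.choose 2 + p.1 * p.2))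
      (norm_one_sub_pow_mul_le hq.le (q ^ k * b) (2 * p.1)))
      (norm_mul_le_of_le (hA p.1) (hP' p.1)))
      (norm_mul_le_of_le (norm_mul_le_of_le (hP (k + (p.1 + p.2))) (hP' p.2))
        (hA' (2 * p.1 + p.2 + 1)))).congr fun p => ?_
  rw [baileyAlpha, add_choose_two, pow_add (-b), neg_pow b p.1]
  rcases neg_one_pow_eq_or ℂ p.1 with hsign | hsign <;> rw [hsign] <;> ring

lemma hasSum_watson (hq : ‖q‖ < 1) {b : ℂ} (hb : ∀ n, q ^ n * b ≠ 1) (k : ℕ) :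
    HasSum (fun s => q ^ (4 * s.choose 2 + (k + 1) * s) * b ^ (2 * s) *
        (1 - q ^ (k + 2 * s) * b) * qPoch b q (k + s) * qPoch q q (k + s) *
        (qPoch q q s)⁻¹ * (qPoch b q s)⁻¹)
      (∑' r, q ^ r.choose 2 * (-b) ^ r * qPoch q q (k + r) * (qPoch q q r)⁻¹) := by
  have h := hasSum_bailey_transform (α := baileyAlpha (q ^ k * b) q)
    (u := fun n => (qPoch q q n)⁻¹) (v := fun n => (qPoch (q ^ k * b) q (n + 1))⁻¹)
    (δ := fun r => q ^ r.choose 2 * (-b) ^ r * qPoch q q (k + r))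
    (sum_range_baileyTerm (pow_mul_ne_one hq.le hq) (pow_mul_pow_mul_ne_one hb k))
    (hasSum_conjugate_bailey hq hb k) (summable_watson hq hb k)
  refine h.congr_fun fun s => ?_
  rw [baileyAlpha, qPoch_add, neg_pow b s]
  rcases neg_one_pow_eq_or ℂ s with hsign | hsign <;> rw [hsign] <;> ring

lemma hasSum_watson_pow (hq : ‖q‖ < 1) (k : ℕ) :
    HasSum (fun s => q ^ (4 * s.choose 2 + 3 * (k + 1) * s) * (1 - q ^ (2 * k + 1 + 2 * s)) *
        qPoch q q (2 * k + s) * (qPoch q q s)⁻¹)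
      (∑' r, q ^ r.choose 2 * (-q ^ (k + 1)) ^ r * qPoch q q (k + r) * (qPoch q q r)⁻¹) := by
  have hq' : ∀ n, q ^ n * q ≠ 1 := pow_mul_ne_one hq.le hq
  have hkq := pow_mul_pow_mul_ne_one hq' k
  simp only [pow_succ q k]
  refine (hasSum_watson hq hkq k).congr_fun fun s => ?_
  have hmerge : qPoch (q ^ k * q) q (k + s) * qPoch q q (k + s) * (qPoch (q ^ k * q) q s)⁻¹ =
      qPoch q q (2 * k + s) := by
    rw [qPoch_add q q k s, ← mul_assoc, mul_inv_cancel_right₀ (qPoch_ne_zero hkq s), mul_comm,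
      ← qPoch_add, two_mul, add_assoc]
  rw [← hmerge]
  ring

end Watson

/-! ### `q`-binomial coefficients -/

section qBinom

variable {q : ℂ}

lemma qBinom_add (q : ℂ) (n j : ℕ) :
    qBinom q (n + j) j = qPoch q q (n + j) * (qPoch q q j)⁻¹ * (qPoch q q n)⁻¹ := by
  rw [qBinom, if_pos (Nat.le_add_left j n), Nat.add_sub_cancel, div_eq_mul_inv, mul_inv, mul_assoc]

lemma qBinom_zero_right (hq : ∀ n, q ^ n * q ≠ 1) (n : ℕ) : qBinom q n 0 = 1 := by
  simp [qBinom, qPoch_zero, qPoch_ne_zero hq n]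

lemma qBinom_self (hq : ∀ n, q ^ n * q ≠ 1) (n : ℕ) : qBinom q n n = 1 := by
  simp [qBinom, qPoch_zero, qPoch_ne_zero hq n]

lemma exists_norm_qBinom_add_le (hq : ‖q‖ < 1) : ∃ C, ∀ n j, ‖qBinom q (n + j) j‖ ≤ C := by
  obtain ⟨P, hP⟩ := exists_norm_qPoch_le hq q
  obtain ⟨P', hP'⟩ := exists_norm_inv_qPoch_le hq (pow_mul_ne_one hq.le hq)
  refine ⟨P * P' * P', fun n j => ?_⟩
  rw [qBinom_add]
  exact norm_mul_le_of_le (norm_mul_le_of_le (hP _) (hP' _)) (hP' _)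

lemma qBinom_inv_add (hq : q ≠ 0) (n l : ℕ) :
    qBinom q⁻¹ (n + l) l = (q ^ (n * l))⁻¹ * qBinom q (n + l) l := by
  rw [qBinom_add, qBinom_add, qPoch_inv hq, qPoch_inv hq, qPoch_inv hq, Nat.add_right_comm,
    add_choose_two, choose_two_succ l]
  simp only [pow_add, mul_inv, inv_inv]
  field_simp
  ring

/-- The polynomial `(y X; q)_n`, as a power series in `X`. -/
noncomputable def qPochSeries (y q : ℂ) (n : ℕ) : PowerSeries ℂ :=
  ∏ i ∈ range n, (1 - PowerSeries.C (q ^ i * y) * PowerSeries.X)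

/-- The power series `∑ j, [n + j, j]_q (y X) ^ j`. -/
noncomputable def qBinomSeries (y q : ℂ) (n : ℕ) : PowerSeries ℂ :=
  PowerSeries.mk fun j => qBinom q (n + j) j * y ^ j

lemma coeff_succ_mul_one_sub {R : Type*} [CommRing R] (f : PowerSeries R) (c : R) (n : ℕ) :
    PowerSeries.coeff (n + 1) (f * (1 - PowerSeries.C c * PowerSeries.X)) =
      PowerSeries.coeff (n + 1) f - c * PowerSeries.coeff n f := by
  rw [mul_sub, mul_one, mul_left_comm, map_sub, PowerSeries.coeff_C_mul,
    PowerSeries.coeff_succ_mul_X]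

lemma qPochSeries_add (y q : ℂ) (m n : ℕ) :
    qPochSeries y q (m + n) = qPochSeries y q m * qPochSeries (q ^ m * y) q n := by
  rw [qPochSeries, qPochSeries, qPochSeries, prod_range_add]
  congr! 5
  ring

lemma qPochSeries_one (y q : ℂ) :
    qPochSeries y q 1 = 1 - PowerSeries.C y * PowerSeries.X := by
  rw [qPochSeries, prod_range_one, pow_zero, one_mul]

lemma qBinomSeries_zero_mul (hq : ∀ n, q ^ n * q ≠ 1) (y : ℂ) :
    qBinomSeries y q 0 * (1 - PowerSeries.C y * PowerSeries.X) = 1 := by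
  ext j
  cases j with
  | zero => simp [qBinomSeries, qBinom_zero_right hq]
  | succ j =>
    rw [coeff_succ_mul_one_sub]
    simp [qBinomSeries, qBinom_self hq, PowerSeries.coeff_one, pow_succ']

lemma qBinomSeries_succ_mul (hq : ∀ n, q ^ n * q ≠ 1) (y : ℂ) (n : ℕ) :
    qBinomSeries y q (n + 1) * (1 - PowerSeries.C (q ^ (n + 1) * y) * PowerSeries.X) =
      qBinomSeries y q n := by
  ext j
  cases j with
  | zero => simp [qBinomSeries, qBinom_zero_right hq]
  | succ j =>
    rw [coeff_succ_mul_one_sub]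
    simp only [qBinomSeries, PowerSeries.coeff_mk, qBinom_add]
    rw [show n + 1 + (j + 1) = n + 1 + j + 1 by ring, show n + (j + 1) = n + 1 + j by ring,
      qPoch_succ q q (n + 1 + j), inv_qPoch hq j, inv_qPoch hq n]
    ring

lemma qBinomSeries_mul_qPochSeries (hq : ∀ n, q ^ n * q ≠ 1) (y : ℂ) (n : ℕ) :
    qBinomSeries y q n * qPochSeries y q (n + 1) = 1 := by
  induction n with
  | zero => rw [zero_add, qPochSeries_one, qBinomSeries_zero_mul hq]
  | succ n ih =>
    rw [qPochSeries_add y q (n + 1), qPochSeries_one, mul_left_comm, qBinomSeries_succ_mul hq,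
      mul_comm, ih]

lemma qBinomSeries_mul_qBinomSeries (hq₀ : q ≠ 0) (hq : ∀ n, q ^ n * q ≠ 1) (k n : ℕ) :
    qBinomSeries 1 q k * qBinomSeries (q ^ n)⁻¹ q n * (1 - PowerSeries.C 1 * PowerSeries.X) =
      qBinomSeries (q ^ n)⁻¹ q (k + n) := by
  have hcancel : q ^ n * (q ^ n)⁻¹ = 1 := mul_inv_cancel₀ (pow_ne_zero n hq₀)
  have hk := qBinomSeries_mul_qPochSeries hq 1 k
  have hn := qBinomSeries_mul_qPochSeries hq (q ^ n)⁻¹ n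
  have hkn := qBinomSeries_mul_qPochSeries hq (q ^ n)⁻¹ (k + n)
  rw [qPochSeries_add, hcancel, qPochSeries_one] at hn
  rw [show k + n + 1 = n + (k + 1) by ring, qPochSeries_add, hcancel] at hkn
  calc qBinomSeries 1 q k * qBinomSeries (q ^ n)⁻¹ q n * (1 - PowerSeries.C 1 * PowerSeries.X)
      = qBinomSeries 1 q k * qBinomSeries (q ^ n)⁻¹ q n *
          (1 - PowerSeries.C 1 * PowerSeries.X) * (qBinomSeries (q ^ n)⁻¹ q (k + n) *
            (qPochSeries (q ^ n)⁻¹ q n * qPochSeries 1 q (k + 1))) := by rw [hkn, mul_one]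
    _ = qBinomSeries 1 q k * qPochSeries 1 q (k + 1) * (qBinomSeries (q ^ n)⁻¹ q n *
          (qPochSeries (q ^ n)⁻¹ q n * (1 - PowerSeries.C 1 * PowerSeries.X))) *
            qBinomSeries (q ^ n)⁻¹ q (k + n) := by ring
    _ = qBinomSeries (q ^ n)⁻¹ q (k + n) := by rw [hk, hn, one_mul, one_mul]

/-- The total coefficient `∑ [k + j, j]_q [n + l, l]_{q⁻¹}` over `j + l = s`; the surgery series
involves the case `n = k`. -/
noncomputable def binomConv (q : ℂ) (k n s : ℕ) : ℂ :=
  ∑ p ∈ antidiagonal s, qBinom q (k + p.1) p.1 * qBinom q⁻¹ (n + p.2) p.2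

lemma binomConv_eq_coeff (hq : q ≠ 0) (k n s : ℕ) :
    binomConv q k n s =
      PowerSeries.coeff s (qBinomSeries 1 q k * qBinomSeries (q ^ n)⁻¹ q n) := by
  rw [binomConv, PowerSeries.coeff_mul]
  refine sum_congr rfl fun p _ => ?_
  rw [qBinomSeries, qBinomSeries, PowerSeries.coeff_mk, PowerSeries.coeff_mk, qBinom_inv_add hq,
    one_pow, mul_one, pow_mul, inv_pow, mul_comm (qBinom q (n + p.2) p.2)]

lemma binomConv_zero (hq₀ : q ≠ 0) (hq : ∀ n, q ^ n * q ≠ 1) (k n : ℕ) :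
    binomConv q k n 0 = 1 := by
  simp [binomConv_eq_coeff hq₀, qBinomSeries, qBinom_zero_right hq]

lemma binomConv_succ_sub (hq₀ : q ≠ 0) (hq : ∀ n, q ^ n * q ≠ 1) (k n s : ℕ) :
    binomConv q k n (s + 1) - binomConv q k n s =
      qBinom q (k + n + (s + 1)) (s + 1) * (q ^ n)⁻¹ ^ (s + 1) := by
  rw [binomConv_eq_coeff hq₀, binomConv_eq_coeff hq₀, ← one_mul (PowerSeries.coeff s _),
    ← coeff_succ_mul_one_sub, qBinomSeries_mul_qBinomSeries hq₀ hq, qBinomSeries,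
    PowerSeries.coeff_mk]

end qBinom

/-! ### The surgery series -/

section Surgery

variable {q : ℂ} {w : ℕ → ℂ}

/-- The summand, indexed by `(k, j, l)`, of the surgery series with the theta factor `θ_N` replaced
by an arbitrary weight `w N`. -/
noncomputable def surgeryTerm (w : ℕ → ℂ) (q : ℂ) (p : ℕ × ℕ × ℕ) : ℂ :=
  w (p.1 + p.2.1 + p.2.2) * qBinom q (p.1 + p.2.1) p.2.1 * qBinom q⁻¹ (p.1 + p.2.2) p.2.2

lemma zpow_neg_mul_sub (hq : q ≠ 0) (m : ℤ) (k : ℕ) :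
    q ^ (-m * (k : ℤ) - m) = (q ^ (-m)) ^ k * q ^ (-m) := by
  rw [sub_eq_add_neg, zpow_add₀ hq, zpow_mul, zpow_natCast]

lemma norm_weight_mul_le (hq₀ : q ≠ 0) (hq : ‖q‖ ≤ 1) {K : ℝ}
    (hw : ∀ N, ‖w N‖ ≤ K * ‖q‖ ^ (2 * N ^ 2)) (k j l : ℕ) :
    ‖w (k + j + l) * (q ^ (k * l))⁻¹‖ ≤ K * ‖q ^ k.choose 2 * (q ^ j * q ^ l)‖ := by
  have hK : 0 ≤ K := by simpa using (norm_nonneg _).trans (hw 0)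
  have hexp : k.choose 2 + (j + l) + k * l ≤ 2 * (k + j + l) ^ 2 := by
    have := Nat.choose_le_pow k 2
    nlinarith [Nat.le_self_pow two_ne_zero j, Nat.le_self_pow two_ne_zero l]
  rw [norm_mul, norm_inv, ← div_eq_mul_inv, div_le_iff₀ (norm_pos_iff.mpr (pow_ne_zero _ hq₀))]
  calc ‖w (k + j + l)‖ ≤ K * ‖q‖ ^ (2 * (k + j + l) ^ 2) := hw _
    _ ≤ K * ‖q‖ ^ (k.choose 2 + (j + l) + k * l) := by
        gcongr K * ?_
        exact pow_le_pow_of_le_one (norm_nonneg q) hq hexp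
    _ = K * ‖q ^ k.choose 2 * (q ^ j * q ^ l)‖ * ‖q ^ (k * l)‖ := by
        simp only [norm_mul, norm_pow, pow_add, mul_assoc]

lemma summable_surgeryTerm (hq₀ : q ≠ 0) (hq : ‖q‖ < 1) (m : ℤ) {K : ℝ}
    (hw : ∀ N, ‖w N‖ ≤ K * ‖q‖ ^ (2 * N ^ 2)) :
    Summable fun p : ℕ × ℕ × ℕ => surgeryTerm w q p * q ^ (-m * (p.1 : ℤ) - m) := by
  obtain ⟨C, hC⟩ := exists_norm_qBinom_add_le hq
  have hgeom := summable_geometric_of_norm_lt_one hq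
  have hmain := summable_mul_of_summable_norm
    (summable_pow_choose_two_mul_pow hq (q ^ (-m))).norm
    (summable_mul_of_summable_norm hgeom.norm hgeom.norm).norm
  refine .of_norm_bounded (hmain.norm.mul_left (K * C * C * ‖q ^ (-m)‖)) ?_
  rintro ⟨k, j, l⟩
  calc ‖surgeryTerm w q (k, j, l) * q ^ (-m * (k : ℤ) - m)‖
      = ‖w (k + j + l) * (q ^ (k * l))⁻¹ * qBinom q (k + j) j * qBinom q (k + l) l‖ *
          ‖(q ^ (-m)) ^ k * q ^ (-m)‖ := by
        rw [surgeryTerm, qBinom_inv_add hq₀, zpow_neg_mul_sub hq₀, norm_mul]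
        ring_nf
    _ ≤ K * ‖q ^ k.choose 2 * (q ^ j * q ^ l)‖ * C * C * ‖(q ^ (-m)) ^ k * q ^ (-m)‖ := by
        gcongr
        exact norm_mul_le_of_le
          (norm_mul_le_of_le (norm_weight_mul_le hq₀ hq.le hw k j l) (hC k j)) (hC k l)
    _ = K * C * C * ‖q ^ (-m)‖ * ‖q ^ k.choose 2 * (q ^ (-m)) ^ k * (q ^ j * q ^ l)‖ := by
        simp only [norm_mul]
        ring

lemma summable_surgeryTerm_fiber (hq₀ : q ≠ 0) (hq : ‖q‖ < 1) {K : ℝ}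
    (hw : ∀ N, ‖w N‖ ≤ K * ‖q‖ ^ (2 * N ^ 2)) (k : ℕ) :
    Summable fun p : ℕ × ℕ => surgeryTerm w q (k, p) := by
  simpa using (summable_surgeryTerm hq₀ hq 0 hw).prod_factor k

lemma hasSum_weight_mul_binomConv {k : ℕ}
    (h : Summable fun p : ℕ × ℕ => surgeryTerm w q (k, p)) :
    HasSum (fun s => w (k + s) * binomConv q k k s) (∑' p : ℕ × ℕ, surgeryTerm w q (k, p)) := by
  refine (hasSum_sum_antidiagonal h.hasSum).congr_fun fun s => ?_
  rw [binomConv, mul_sum]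
  refine sum_congr rfl fun p hp => ?_
  rw [surgeryTerm, add_assoc, mem_antidiagonal.mp hp, mul_assoc]

lemma hasSum_weight_mul_qBinom (hq₀ : q ≠ 0) (hq : ∀ n, q ^ n * q ≠ 1) {k : ℕ}
    (h : Summable fun p : ℕ × ℕ => surgeryTerm w q (k, p))
    (h' : Summable fun p : ℕ × ℕ => surgeryTerm (fun N => w (N + 1)) q (k, p)) :
    HasSum (fun s => w (k + s) * (qBinom q (k + k + s) s * (q ^ k)⁻¹ ^ s))
      (∑' p : ℕ × ℕ, surgeryTerm (fun N => w N - w (N + 1)) q (k, p)) := by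
  have hb : HasSum (fun s => w (k + (s + 1)) * binomConv q k k s) _ :=
    hasSum_weight_mul_binomConv (w := fun N => w (N + 1)) h'
  have hsub : ∑' p : ℕ × ℕ, surgeryTerm (fun N => w N - w (N + 1)) q (k, p) =
      ∑' p, surgeryTerm w q (k, p) - ∑' p, surgeryTerm (fun N => w (N + 1)) q (k, p) := by
    rw [← h.tsum_sub h']
    simp only [surgeryTerm, sub_mul]
  rw [hsub]
  exact hasSum_mul_of_hasSum_sub_succ (w := fun s => w (k + s)) (c := binomConv q k k)
    (by simp [binomConv_zero hq₀ hq, qBinom_zero_right hq])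
    (fun s => (binomConv_succ_sub hq₀ hq k k s).symm) (hasSum_weight_mul_binomConv h) hb

/-- The difference `q ^ T(2 N) - q ^ T(2 N + 1)` with `T(n) = n (n + 1) / 2`. Up to the factor
`-q ^ (1 / 8)`, the theta factor `θ_N` is `thetaDiff q N - thetaDiff q (N + 1)`. -/
noncomputable def thetaDiff (q : ℂ) (N : ℕ) : ℂ :=
  q ^ (N * (2 * N + 1)) * (1 - q ^ (2 * N + 1))

lemma norm_thetaDiff_le (hq : ‖q‖ ≤ 1) (N : ℕ) : ‖thetaDiff q N‖ ≤ 2 * ‖q‖ ^ (2 * N ^ 2) := by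
  have hdiff : ‖1 - q ^ (2 * N + 1)‖ ≤ 2 := by
    simpa [one_add_one_eq_two] using norm_one_sub_pow_mul_le hq 1 (2 * N + 1)
  rw [thetaDiff, norm_mul, norm_pow, mul_comm]
  exact mul_le_mul hdiff (pow_le_pow_of_le_one (norm_nonneg q) hq (by nlinarith)) (by positivity)
    two_pos.le

lemma norm_thetaDiff_succ_le (hq : ‖q‖ ≤ 1) (N : ℕ) :
    ‖thetaDiff q (N + 1)‖ ≤ 2 * ‖q‖ ^ (2 * N ^ 2) := by
  refine (norm_thetaDiff_le hq (N + 1)).trans ?_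
  gcongr 2 * ?_
  exact pow_le_pow_of_le_one (norm_nonneg q) hq (by gcongr; omega)

lemma tsum_surgeryTerm_fiber (hq₀ : q ≠ 0) (hq : ‖q‖ < 1) (k : ℕ) :
    ∑' p : ℕ × ℕ, surgeryTerm (fun N => thetaDiff q N - thetaDiff q (N + 1)) q (k, p) =
      ∑' r, q ^ (k * (2 * k + 1)) * (qPoch q q (2 * k))⁻¹ *
        (q ^ r.choose 2 * (-q ^ (k + 1)) ^ r * qPoch q q (k + r) * (qPoch q q r)⁻¹) := by
  have hleft := hasSum_weight_mul_qBinom hq₀ (pow_mul_ne_one hq.le hq)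
    (summable_surgeryTerm_fiber hq₀ hq (norm_thetaDiff_le hq.le) k)
    (summable_surgeryTerm_fiber hq₀ hq (norm_thetaDiff_succ_le hq.le) k)
  have hright := (hasSum_watson_pow hq k).mul_left
    (q ^ (k * (2 * k + 1)) * (qPoch q q (2 * k))⁻¹)
  rw [tsum_mul_left]
  refine hleft.unique (hright.congr_fun fun s => ?_)
  have hexp : (k + s) * (2 * (k + s) + 1) =
      k * (2 * k + 1) + (4 * s.choose 2 + 3 * (k + 1) * s) + k * s := by
    rw [mul_two_mul_add_one, mul_two_mul_add_one, add_choose_two]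
    ring
  rw [thetaDiff, qBinom_add, hexp, pow_add, inv_pow, ← pow_mul, ← two_mul,
    show 2 * (k + s) + 1 = 2 * k + 1 + 2 * s by ring]
  field_simp
  ring

end Surgery

/-! ### The series `Z_{m,0}` -/

section Z

variable {q : ℂ}

/-- A parametrization of the support of `beta`. -/
def betaIndex (p : ℕ × ℕ) : ℤ × ℤ := (-(p.1 : ℤ) - 1, -(p.1 : ℤ) - p.2 - 1)

lemma betaIndex_injective : Function.Injective betaIndex := by
  rintro ⟨a, b⟩ ⟨c, d⟩ h
  simp only [betaIndex, Prod.mk.injEq] at h ⊢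
  omega

lemma ZTerm_eq_zero (m n : ℤ) (q : ℂ) {p : ℤ × ℤ} (hp : p ∉ Set.range betaIndex) :
    ZTerm m n q p = 0 := by
  obtain ⟨k, l⟩ := p
  have hkl : ¬ (l ≤ k ∧ k ≤ -1) := by
    rintro ⟨hlk, hk⟩
    refine hp ⟨((-k - 1).toNat, (k - l).toNat), ?_⟩
    simp only [betaIndex, Prod.mk.injEq]
    omega
  simp [ZTerm, beta, hkl]

lemma beta_exponent_betaIndex (k r : ℕ) :
    3 * (-(k : ℤ) - 1) * (-(k : ℤ) - 1 + 1) / 2 +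
        (-(k : ℤ) - r - 1) * (-(k : ℤ) - r - 1 + 1) / 2 + (-(k : ℤ) - 1) + 1 =
      (k * (2 * k + 1) + (r.choose 2 + (k + 1) * r) : ℕ) := by
  have hk : 3 * (-(k : ℤ) - 1) * (-(k : ℤ) - 1 + 1) = 3 * (k + 1).choose 2 * 2 := by
    have := two_mul_choose_two_succ k
    zify at this
    linarith
  have hkr : (-(k : ℤ) - r - 1) * (-(k : ℤ) - r - 1 + 1) = (k + r + 1).choose 2 * 2 := by
    have := two_mul_choose_two_succ (k + r)
    zify at this
    linarith
  rw [hk, hkr, Int.mul_ediv_cancel _ two_ne_zero, Int.mul_ediv_cancel _ two_ne_zero,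
    mul_two_mul_add_one, choose_two_succ, choose_two_succ, add_choose_two]
  push_cast
  ring

lemma neg_one_zpow_betaIndex (k r : ℕ) :
    (-1 : ℂ) ^ (-(k : ℤ) - 1 + (-(k : ℤ) - r - 1)) = (-1) ^ r := by
  rw [show -(k : ℤ) - 1 + (-(k : ℤ) - r - 1) = 2 * (-(k : ℤ) - 1 - r) + (r : ℕ) by ring,
    zpow_add₀ (by norm_num), zpow_mul, zpow_natCast]
  norm_num

lemma ZTerm_betaIndex (m : ℤ) (q : ℂ) (k r : ℕ) :
    ZTerm m 0 q (betaIndex (k, r)) =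
      q ^ (k * (2 * k + 1)) * (qPoch q q (2 * k))⁻¹ *
        (q ^ r.choose 2 * (-q ^ (k + 1)) ^ r * qPoch q q (k + r) * (qPoch q q r)⁻¹) *
          q ^ (-m * (k : ℤ) - m) := by
  have hsupp : (betaIndex (k, r)).2 ≤ (betaIndex (k, r)).1 ∧ (betaIndex (k, r)).1 ≤ -1 := by
    simp only [betaIndex]
    omega
  rw [ZTerm, beta, if_pos hsupp]
  simp only [betaIndex]
  rw [beta_exponent_betaIndex, neg_one_zpow_betaIndex, zpow_natCast,
    show (-(-(k : ℤ) - r - 1) - 1).toNat = k + r by omega,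
    show (-2 * (-(k : ℤ) - 1) - 2).toNat = 2 * k by omega,
    show (-(k : ℤ) - 1 - (-(k : ℤ) - r - 1)).toNat = r by omega,
    show m * (-(k : ℤ) - 1) + 0 * (-(k : ℤ) - r - 1) = -m * (k : ℤ) - m by ring,
    neg_pow (q ^ (k + 1)) r, ← pow_mul, pow_add, pow_add, div_eq_mul_inv, mul_inv]
  ring

lemma summable_ZTerm_betaIndex (hq₀ : q ≠ 0) (hq : ‖q‖ < 1) (m : ℤ) :
    Summable fun p => ZTerm m 0 q (betaIndex p) := by
  obtain ⟨P, hP⟩ := exists_norm_qPoch_le hq q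
  obtain ⟨P', hP'⟩ := exists_norm_inv_qPoch_le hq (pow_mul_ne_one hq.le hq)
  have hpow (n : ℕ) : ‖q ^ n‖ ≤ 1 := by
    rw [norm_pow]; exact pow_le_one₀ (norm_nonneg q) hq.le
  have hmain := summable_mul_of_summable_norm
    (summable_pow_choose_two_mul_pow hq (q ^ 3 * q ^ (-m))).norm
    (summable_pow_choose_two_mul_pow hq (-q)).norm
  refine ((summable_mul_of_norm_le hmain.norm fun p : ℕ × ℕ =>
    norm_mul_le_of_le (hpow (3 * p.1.choose 2 + p.1 * p.2))
      (norm_mul_le_of_le (hP' (2 * p.1)) (norm_mul_le_of_le (hP (p.1 + p.2)) (hP' p.2)))).mul_right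
    (q ^ (-m))).congr fun p => ?_
  rw [ZTerm_betaIndex, zpow_neg_mul_sub hq₀, mul_two_mul_add_one, neg_pow (q ^ (p.1 + 1)),
    neg_pow q p.2]
  ring

lemma summable_ZTerm (hq₀ : q ≠ 0) (hq : ‖q‖ < 1) (m : ℤ) : Summable (ZTerm m 0 q) :=
  (betaIndex_injective.summable_iff fun _ hp => ZTerm_eq_zero m 0 q hp).mp
    (summable_ZTerm_betaIndex hq₀ hq m)

lemma Z_eq_tsum_betaIndex (m n : ℤ) (q : ℂ) : Z m n q = ∑' p, ZTerm m n q (betaIndex p) :=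
  (betaIndex_injective.tsum_eq fun _ hp =>
    not_imp_comm.mp (ZTerm_eq_zero m n q) (Function.mem_support.mp hp)).symm

lemma hasSum_surgeryTerm (hq₀ : q ≠ 0) (hq : ‖q‖ < 1) (m : ℤ) :
    HasSum (fun p : ℕ × ℕ × ℕ =>
      surgeryTerm (fun N => thetaDiff q N - thetaDiff q (N + 1)) q p * q ^ (-m * (p.1 : ℤ) - m))
      (Z m 0 q) := by
  have hbound (N : ℕ) : ‖thetaDiff q N - thetaDiff q (N + 1)‖ ≤ (2 + 2) * ‖q‖ ^ (2 * N ^ 2) := by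
    rw [add_mul]
    exact norm_sub_le_of_le (norm_thetaDiff_le hq.le N) (norm_thetaDiff_succ_le hq.le N)
  have hsum := summable_surgeryTerm hq₀ hq m hbound
  convert hsum.hasSum using 1
  rw [Z_eq_tsum_betaIndex, (summable_ZTerm_betaIndex hq₀ hq m).tsum_prod, hsum.tsum_prod]
  refine tsum_congr fun k => ?_
  simp only [ZTerm_betaIndex]
  rw [tsum_mul_right, tsum_mul_right, tsum_surgeryTerm_fiber hq₀ hq]

end Z

/-! ### Rational powers of `q` -/

lemma qpow_add (τ : ℂ) (r s : ℚ) : qpow τ (r + s) = qpow τ r * qpow τ s := by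
  rw [qpow, qpow, qpow, ← Complex.exp_add]
  push_cast
  ring_nf

lemma qpow_natCast (τ : ℂ) (n : ℕ) : qpow τ n = qpow τ 1 ^ n := by
  rw [qpow, qpow, ← Complex.exp_nat_mul]
  push_cast
  ring_nf

lemma qpow_ne_zero (τ : ℂ) (r : ℚ) : qpow τ r ≠ 0 := Complex.exp_ne_zero _

lemma norm_qpow_one_lt_one {τ : ℂ} (hτ : 0 < τ.im) : ‖qpow τ 1‖ < 1 := by
  have hre : (2 * Real.pi * Complex.I * ((1 : ℚ) : ℂ) * τ).re = -(2 * Real.pi * τ.im) := by simp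
  rw [qpow, Complex.norm_exp, Real.exp_lt_one_iff, hre, neg_lt_zero]
  exact mul_pos Real.two_pi_pos hτ

lemma thetaTerm_eq (τ : ℂ) (N : ℕ) :
    thetaTerm τ N =
      -qpow τ (1 / 8) * (thetaDiff (qpow τ 1) N - thetaDiff (qpow τ 1) (N + 1)) := by
  have h₁ : 2 * ((N : ℚ) + 1 / 4) ^ 2 = 1 / 8 + (N * (2 * N + 1) : ℕ) := by
    push_cast; ring
  have h₃ : 2 * ((N : ℚ) + 3 / 4) ^ 2 = 1 / 8 + (N * (2 * N + 1) + (2 * N + 1) : ℕ) := by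
    push_cast; ring
  have h₅ : 2 * ((N : ℚ) + 5 / 4) ^ 2 = 1 / 8 + ((N + 1) * (2 * (N + 1) + 1) : ℕ) := by
    push_cast; ring
  have h₇ : 2 * ((N : ℚ) + 7 / 4) ^ 2 =
      1 / 8 + ((N + 1) * (2 * (N + 1) + 1) + (2 * (N + 1) + 1) : ℕ) := by
    push_cast; ring
  rw [thetaTerm, h₁, h₃, h₅, h₇]
  simp only [qpow_add, qpow_natCast, thetaDiff]
  ring

lemma hasSum_ZhatTermM {τ : ℂ} (hτ : 0 < τ.im) (m : ℤ) :
    HasSum (ZhatTermM m τ) (-qpow τ (1 / 8) * Z m 0 (qpow τ 1)) := by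
  refine ((hasSum_surgeryTerm (qpow_ne_zero τ 1) (norm_qpow_one_lt_one hτ) m).mul_left
    (-qpow τ (1 / 8))).congr_fun fun p => ?_
  rw [ZhatTermM, ZhatTerm, thetaTerm_eq, surgeryTerm]
  ring

lemma ZhatM_eq {τ : ℂ} (hτ : 0 < τ.im) (m : ℤ) :
    ZhatM m τ = -qpow τ (1 / 2) * Z m 0 (qpow τ 1) := by
  rw [ZhatM, (hasSum_ZhatTermM hτ m).tsum_eq, show (1 / 2 : ℚ) = 3 / 8 + 1 / 8 by norm_num,
    qpow_add]
  ring

lemma ZhatTermM_zero (τ : ℂ) : ZhatTermM 0 τ = ZhatTerm τ := by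
  funext p
  simp [ZhatTermM]

end FigEightSurgery

theorem mainTheorem6 (τ : ℂ) (hτ : 0 < τ.im) :
    (∀ m : ℤ,
      Summable (FigEightSurgery.ZhatTermM m τ) ∧
      Summable (FigEightSurgery.ZTerm m 0 (FigEightSurgery.qpow τ 1)) ∧
      FigEightSurgery.ZhatM m τ =
        -FigEightSurgery.qpow τ (1 / 2) *
          FigEightSurgery.Z m 0 (FigEightSurgery.qpow τ 1)) ∧
    (Summable (FigEightSurgery.ZhatTerm τ) ∧
      FigEightSurgery.Zhat τ =
        -FigEightSurgery.qpow τ (1 / 2) *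
          FigEightSurgery.Z 0 0 (FigEightSurgery.qpow τ 1)) := by
  refine ⟨fun m => ⟨(FigEightSurgery.hasSum_ZhatTermM hτ m).summable,
    FigEightSurgery.summable_ZTerm (FigEightSurgery.qpow_ne_zero τ 1)
      (FigEightSurgery.norm_qpow_one_lt_one hτ) m, FigEightSurgery.ZhatM_eq hτ m⟩, ?_, ?_⟩
  · rw [← FigEightSurgery.ZhatTermM_zero]
    exact (FigEightSurgery.hasSum_ZhatTermM hτ 0).summable
  · rw [FigEightSurgery.Zhat, ← FigEightSurgery.ZhatTermM_zero]
    exact FigEightSurgery.ZhatM_eq hτ 0
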